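/- Let $s\ge 4$ be an integer, $q=2^s$ and $h=q/4$. Let $\beta$ be a primitive $(q+1)$-th root of unity in an extension field of $\mathbb{F}_q$ (for instance in $\mathbb{F}_{q^2}$), and for $j\ge 0$ let $\mathrm{M}_{\beta^j}(x)$ be the minimal polynomial of $\beta^j$ over $\mathbb{F}_q$. Let $\mathcal{C}_{(q,q+1,3,h)}$ be the BCH code over $\mathbb{F}_q$ of length $q+1$ and designed distance $3$, i.e. the cyclic code of length $q+1$ generated by $\mathrm{lcm}\left(\mathrm{M}_{\beta^h}(x),\mathrm{M}_{\beta^{h+1}}(x)\right)$, where $(c_0,\dots,c_q)\in\mathbb{F}_q^{q+1}$ is identified with the class of $c_0+c_1x+\cdots+c_qx^q$ in $\mathbb{F}_q[x]/(x^{q+1}-1)$. Then the binary subfield subcode $$\mathcal{C}_{(q,q+1,3,h)}|_{\mathbb{F}_2}=\mathcal{C}_{(q,q+1,3,h)}\cap\mathbb{F}_2^{\,q+1},$$ regarded as a linear code over $\mathbb{F}_2$, has parameters $[q+1,\;q+1-4s,\;d]$ with $d\ge 5$; that is, it has length $q+1$, dimension $q+1-4s$, and minimum distance $d\ge 5$.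 -/

import Mathlib

open Polynomial

namespace BCH

noncomputable section

/-- The `F`-linear identification of a word `(c₀, …, c_{n-1})` with the residue class of
`c₀ + c₁ x + ⋯ + c_{n-1} x^{n-1}` in `F[x] / (x^n - 1)`. -/
def wordToQuotient (F : Type*) [Field F] (n : ℕ) :
    (Fin n → F) →ₗ[F] (F[X] ⧸ Ideal.span {(X ^ n - 1 : F[X])}) :=
  (Ideal.Quotient.mkₐ F (Ideal.span {(X ^ n - 1 : F[X])})).toLinearMap ∘ₗ
    ∑ i : Fin n, Polynomial.monomial (i : ℕ) ∘ₗ LinearMap.proj i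

/-- The cyclic code of length `n` over `F` generated by `g`: the words whose residue class lies
in the ideal of `F[x] / (x^n - 1)` generated by the class of `g`. -/
def cyclicCode {F : Type*} [Field F] (n : ℕ) (g : F[X]) : Submodule F (Fin n → F) :=
  ((Ideal.span {Ideal.Quotient.mk (Ideal.span {(X ^ n - 1 : F[X])}) g}).restrictScalars F).comap
    (wordToQuotient F n)

/-- The (monic) least common multiple over `F` of the minimal polynomials over `F` of
`β ^ h, β ^ (h + 1), …, β ^ (h + δ - 2)`. -/
def bchGenerator (F : Type*) {K : Type*} [Field F] [Field K] [Algebra F K]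
    (δ h : ℕ) (β : K) : F[X] :=
  letI : DecidableEq F := Classical.decEq F
  letI : NormalizedGCDMonoid F[X] := UniqueFactorizationMonoid.toNormalizedGCDMonoid F[X]
  (Finset.range (δ - 1)).lcm fun j => minpoly F (β ^ (h + j))

/-- The BCH code over `F` of length `n` and designed distance `δ`, starting at exponent `h`,
with respect to `β` (in use: a primitive `n`-th root of unity in an extension of `F`). -/
def bchCode (F : Type*) {K : Type*} [Field F] [Field K] [Algebra F K]
    (n δ h : ℕ) (β : K) : Submodule F (Fin n → F) :=
  cyclicCode n (bchGenerator F δ h β)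

/-- The subfield subcode of `C` with respect to a subfield `k` of `F`: the words over `k` that
are codewords of `C`, as a linear code over `k`. -/
def subfieldSubcode (k : Type*) {F : Type*} [Field k] [Field F] [Algebra k F] {n : ℕ}
    (C : Submodule F (Fin n → F)) : Submodule k (Fin n → k) :=
  (C.restrictScalars k).comap ((Algebra.linearMap k F).compLeft (Fin n))

/-- `C` is a linear code with parameters `[n, k, d]`: length `n`, dimension `k`, and `d` is the
minimum Hamming weight of a nonzero codeword. -/
structure HasParameters {F : Type*} [Field F] [DecidableEq F] {n : ℕ}
    (C : Submodule F (Fin n → F)) (k d : ℕ) : Prop where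
  dimension : Module.finrank F C = k
  minDistance : IsLeast {w : ℕ | ∃ c ∈ C, c ≠ 0 ∧ hammingNorm c = w} d

end

end BCH

/-! A binary polynomial satisfies p(x^2) = p(x)^2, so its zeros are closed under squaring. Now h =
2^(s-2) is a power of 2, and 4(h+1) = (q+1) + 3, so for binary words vanishing at β^h and β^(h+1)
means vanishing at β and β^3 (`mem_subfieldSubcode_bchCode_iff`). The 2-cyclotomic cosets of 1 and 3
modulo 2^s+1 are disjoint, each of size 2s; hence the generator has degree 4s
(`finrank_subfieldSubcode_bchCode`). The zeros include β, β^2, β^3, β^4, and the BCH bound gives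
weight at least 5 (`five_le_hammingNorm`). -/

open Polynomial

namespace BCH

/-! ### Cyclic codes: membership, dimension, BCH bound. -/

section CyclicCodes

variable {F K : Type*} [Field F] [Field K] [Algebra F K]

/-- The polynomial `c₀ + c₁ x + ⋯ + c_{n-1} x^{n-1}` of a word. -/
noncomputable def wordPoly {n : ℕ} (c : Fin n → F) : F[X] :=
  ∑ i : Fin n, monomial (i : ℕ) (c i)

theorem wordToQuotient_apply (n : ℕ) (c : Fin n → F) :
    wordToQuotient F n c = Ideal.Quotient.mk (Ideal.span {(X ^ n - 1 : F[X])}) (wordPoly c) := by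
  simp [wordToQuotient, wordPoly]

theorem aeval_wordPoly {n : ℕ} (c : Fin n → F) (x : K) :
    aeval x (wordPoly c) = ∑ i : Fin n, algebraMap F K (c i) * x ^ (i : ℕ) := by
  simp [wordPoly, aeval_monomial]

theorem mem_cyclicCode_iff {n : ℕ} {g : F[X]} (hg : g ∣ X ^ n - 1) (c : Fin n → F) :
    c ∈ cyclicCode n g ↔ g ∣ wordPoly c := by
  rw [cyclicCode, Submodule.mem_comap, Submodule.restrictScalars_mem, wordToQuotient_apply,
    Ideal.mem_span_singleton]
  constructor
  · rintro ⟨a, ha⟩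
    obtain ⟨a, rfl⟩ := Ideal.Quotient.mk_surjective a
    rw [← map_mul, Ideal.Quotient.eq, Ideal.mem_span_singleton] at ha
    exact (dvd_sub_left (dvd_mul_right g a)).1 (hg.trans ha)
  · exact fun h => map_dvd _ h

theorem bchGenerator_dvd_iff (δ h : ℕ) (β : K) (p : F[X]) :
    bchGenerator F δ h β ∣ p ↔ ∀ j < δ - 1, aeval (β ^ (h + j)) p = 0 := by
  simp only [bchGenerator, Finset.lcm_dvd_iff, Finset.mem_range, minpoly.dvd_iff]

theorem mem_bchCode_iff {n : ℕ} (δ h : ℕ) {β : K} (hβ : β ^ n = 1) (c : Fin n → F) :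
    c ∈ bchCode F n δ h β ↔
      ∀ j < δ - 1, ∑ i : Fin n, algebraMap F K (c i) * (β ^ (h + j)) ^ (i : ℕ) = 0 := by
  rw [bchCode, mem_cyclicCode_iff, bchGenerator_dvd_iff]
  · simp only [aeval_wordPoly]
  · rw [bchGenerator_dvd_iff]
    intro j _
    rw [map_sub, map_pow, aeval_X, map_one, ← pow_mul, mul_comm, pow_mul, hβ, one_pow, sub_self]

/-- A code consisting of the words of length `n` divisible by a monic `g` has
codimension `deg g`. -/
theorem finrank_of_mem_iff_dvd {n : ℕ} {g : F[X]} (hg : g.Monic) (hn : g.natDegree ≤ n)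
    (C : Submodule F (Fin n → F)) (hC : ∀ c, c ∈ C ↔ g ∣ wordPoly c) :
    Module.finrank F C = n - g.natDegree := by
  let φ : (Fin n → F) →ₗ[F] AdjoinRoot g :=
    (AdjoinRoot.mkₐ g).toLinearMap ∘ₗ
      ∑ i : Fin n, Polynomial.monomial (i : ℕ) ∘ₗ LinearMap.proj i
  have hφ : ∀ c, φ c = AdjoinRoot.mk g (wordPoly c) := fun c => by
    simp [φ, wordPoly]
  have hker : LinearMap.ker φ = C := by
    ext c
    rw [LinearMap.mem_ker, hφ, AdjoinRoot.mk_eq_zero, hC]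
  have hsurj : Function.Surjective φ := by
    intro y
    obtain ⟨p, rfl⟩ := AdjoinRoot.mk_surjective y
    refine ⟨fun i => (p %ₘ g).coeff i, ?_⟩
    have hp : wordPoly (fun i : Fin n => (p %ₘ g).coeff i) = p %ₘ g := by
      rw [wordPoly, Fin.sum_univ_eq_sum_range (fun i => monomial i ((p %ₘ g).coeff i)) n]
      -- For g = 1 the remainder is 0 and its `natDegree` is not below that of g.
      by_cases h1 : g = 1
      · simp [h1]
      · exact (as_sum_range' _ _ ((natDegree_modByMonic_lt p hg h1).trans_le hn)).symm
    rw [hφ, hp, AdjoinRoot.mk_eq_mk]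
    exact ⟨-(p /ₘ g), by linear_combination modByMonic_add_div p g⟩
  have h := LinearMap.finrank_range_add_finrank_ker φ
  rw [LinearMap.range_eq_top.2 hsurj, finrank_top, hker, Module.finrank_fin_fun,
    (AdjoinRoot.powerBasis' hg).finrank, AdjoinRoot.powerBasis'_dim] at h
  omega

/-- The BCH bound for the exponents `1, …, m`. -/
theorem lt_hammingNorm_of_sum_pow_eq_zero [DecidableEq F] {n m : ℕ} {β : K}
    (hβ : IsPrimitiveRoot β n) (c : Fin n → F) (hc : c ≠ 0)
    (h : ∀ j, 1 ≤ j → j ≤ m → ∑ i : Fin n, algebraMap F K (c i) * (β ^ j) ^ (i : ℕ) = 0) :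
    m < hammingNorm c := by
  by_contra! hle
  obtain ⟨i₀, hi₀⟩ := Function.ne_iff.1 hc
  have hn : n ≠ 0 := fun h0 => by subst h0; exact i₀.elim0
  let S : Finset (Fin n) := {i | c i ≠ 0}
  have hS : S.card ≤ m := hle
  have hi₀S : i₀ ∈ S := by simpa [S] using hi₀
  -- P kills every support position except i₀. The parity checks, weighted by the coefficients of P,
  -- then leave only the nonzero term at i₀. The extra factor β^i in `hsum` shifts the exponents 0,
  -- …, m-1 to 1, …, m.
  let P : K[X] := ∏ i ∈ S.erase i₀, (X - C (β ^ (i : ℕ)))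
  have hPdeg : P.natDegree < m := by
    rw [natDegree_finsetProd_X_sub_C_eq_card, Finset.card_erase_of_mem hi₀S]
    have := Finset.card_pos.2 ⟨i₀, hi₀S⟩
    omega
  have hsum : ∑ i : Fin n, algebraMap F K (c i) * (β ^ (i : ℕ) * P.eval (β ^ (i : ℕ))) = 0 := by
    simp only [eval_eq_sum_range' hPdeg, Finset.mul_sum]
    rw [Finset.sum_comm]
    refine Finset.sum_eq_zero fun j hj => ?_
    rw [Finset.mem_range] at hj
    have := h (j + 1) (by omega) (by omega)
    calc _ = P.coeff j * ∑ i : Fin n, algebraMap F K (c i) * (β ^ (j + 1)) ^ (i : ℕ) := by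
            rw [Finset.mul_sum]
            refine Finset.sum_congr rfl fun i _ => ?_
            rw [← pow_mul, ← pow_mul, add_mul, one_mul, pow_add, mul_comm j]
            ring
      _ = 0 := by rw [this, mul_zero]
  rw [Finset.sum_eq_single i₀] at hsum
  · have h1 : algebraMap F K (c i₀) ≠ 0 := by simpa using hi₀
    have h2 : β ^ (i₀ : ℕ) ≠ 0 := pow_ne_zero _ (hβ.ne_zero hn)
    have h3 : P.eval (β ^ (i₀ : ℕ)) ≠ 0 := by
      rw [eval_prod, Finset.prod_ne_zero_iff]
      intro i hi
      rw [eval_sub, eval_X, eval_C, sub_ne_zero]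
      intro heq
      exact (Finset.mem_erase.1 hi).1 (Fin.ext (hβ.pow_inj i₀.2 i.2 heq).symm)
    exact mul_ne_zero h1 (mul_ne_zero h2 h3) hsum
  · intro i _ hi
    by_cases hci : c i = 0
    · simp [hci]
    · have : P.eval (β ^ (i : ℕ)) = 0 := by
        rw [eval_prod]
        exact Finset.prod_eq_zero (i := i) (by simp [S, hi, hci]) (by simp)
      simp [this]
  · simp

end CyclicCodes

/-! ### Frobenius conjugates over the binary field. -/

section BinaryPolynomials

variable {K : Type*} [Field K] [Algebra (ZMod 2) K]

theorem aeval_pow_two_pow (p : (ZMod 2)[X]) (x : K) (i : ℕ) :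
    aeval (x ^ 2 ^ i) p = aeval x p ^ 2 ^ i := by
  have : CharP K 2 := charP_of_injective_algebraMap (algebraMap (ZMod 2) K).injective 2
  rw [aeval_def, aeval_def, ← iterateFrobenius_def, ← iterateFrobenius_def, hom_eval₂]
  congr 1
  exact Subsingleton.elim _ _

theorem aeval_pow_two_pow_eq_zero_iff (p : (ZMod 2)[X]) (x : K) (i : ℕ) :
    aeval (x ^ 2 ^ i) p = 0 ↔ aeval x p = 0 := by
  rw [aeval_pow_two_pow, pow_eq_zero_iff (by positivity)]

/-- Upper bound: all of F₂(x) consists of roots of X^(2^m) - X, so it has at most 2^m elements.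
Lower bound: the m distinct conjugates are roots of the minimal polynomial. -/
theorem minpoly_natDegree_eq_of_conjugates {x : K} {m : ℕ} (hm : m ≠ 0) (hx : x ^ 2 ^ m = x)
    (hinj : Set.InjOn (fun i => x ^ 2 ^ i) (Finset.range m)) :
    (minpoly (ZMod 2) x).natDegree = m := by
  have hXm : (X ^ 2 ^ m - X : (ZMod 2)[X]).natDegree = 2 ^ m :=
    FiniteField.X_pow_card_pow_sub_X_natDegree_eq _ hm (by norm_num)
  have hXm0 : (X ^ 2 ^ m - X : K[X]) ≠ 0 :=
    FiniteField.X_pow_card_pow_sub_X_ne_zero _ hm (by norm_num)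
  have hint : IsIntegral (ZMod 2) x := by
    refine IsAlgebraic.isIntegral ⟨X ^ 2 ^ m - X, ?_, by simp [hx]⟩
    exact FiniteField.X_pow_card_pow_sub_X_ne_zero _ hm (by norm_num)
  apply le_antisymm
  · let pb := IntermediateField.adjoin.powerBasis hint
    let L := IntermediateField.adjoin (ZMod 2) {x}
    have : Module.Finite (ZMod 2) L := pb.finite
    have : Finite L := Module.finite_of_finite (ZMod 2)
    have hfr : Module.finrank (ZMod 2) L = (minpoly (ZMod 2) x).natDegree :=
      IntermediateField.adjoin.finrank hint
    have hcard : Nat.card L = 2 ^ (minpoly (ZMod 2) x).natDegree := by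
      rw [Module.natCard_eq_pow_finrank (K := ZMod 2), hfr, Nat.card_zmod]
    have hfix : ∀ y ∈ L, y ^ 2 ^ m = y := by
      intro y hy
      obtain ⟨p, rfl⟩ : ∃ p : (ZMod 2)[X], aeval x p = y := by
        have : y ∈ Algebra.adjoin (ZMod 2) {x} := by
          rw [← IntermediateField.adjoin_simple_toSubalgebra_of_isAlgebraic hint.isAlgebraic]
          exact hy
        rwa [Algebra.adjoin_singleton_eq_range_aeval] at this
      rw [← aeval_pow_two_pow, hx]
    have hle : Nat.card L ≤ 2 ^ m := by
      classical
      have hsub : (L : Set K) ⊆ (X ^ 2 ^ m - X : K[X]).roots.toFinset := by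
        intro y hy
        simp [mem_roots hXm0, hfix y hy]
      calc Nat.card L = (L : Set K).ncard := rfl
        _ ≤ ((X ^ 2 ^ m - X : K[X]).roots.toFinset : Set K).ncard :=
            Set.ncard_le_ncard hsub (Finset.finite_toSet _)
        _ = (X ^ 2 ^ m - X : K[X]).roots.toFinset.card := Set.ncard_coe_finset _
        _ ≤ (X ^ 2 ^ m - X : K[X]).roots.card := Multiset.toFinset_card_le _
        _ ≤ (X ^ 2 ^ m - X : K[X]).natDegree := card_roots' _
        _ = 2 ^ m := FiniteField.X_pow_card_pow_sub_X_natDegree_eq _ hm (by norm_num)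
    rw [hcard] at hle
    exact (Nat.pow_le_pow_iff_right (by norm_num)).1 hle
  · classical
    have hmp : (minpoly (ZMod 2) x).map (algebraMap (ZMod 2) K) ≠ 0 :=
      map_ne_zero (minpoly.ne_zero hint)
    have hsub : (Finset.range m).image (fun i => x ^ 2 ^ i) ⊆
        ((minpoly (ZMod 2) x).map (algebraMap (ZMod 2) K)).roots.toFinset := by
      intro y hy
      obtain ⟨i, -, rfl⟩ := Finset.mem_image.1 hy
      rw [Multiset.mem_toFinset, mem_roots hmp, IsRoot.def, eval_map_algebraMap,
        aeval_pow_two_pow_eq_zero_iff, minpoly.aeval]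
    calc m = ((Finset.range m).image (fun i => x ^ 2 ^ i)).card := by
            rw [Finset.card_image_of_injOn hinj, Finset.card_range]
      _ ≤ _ := Finset.card_le_card hsub
      _ ≤ _ := Multiset.toFinset_card_le _
      _ ≤ _ := card_roots' _
      _ = _ := natDegree_map _

end BinaryPolynomials

/-! ### Arithmetic of 2-cyclotomic cosets modulo 2^s+1. -/

section CyclotomicCosets

/-- This makes the coset of 3 have full size 2s. Since 2^s ≡ -1, the case d > s reduces to
3(2^(d-s)+1); by size any quotient must be 1, which fails modulo 8 (d < s) or modulo 4 (d > s),
apart from small exponents. -/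
theorem not_dvd_three_mul_two_pow_sub_one {s d : ℕ} (hs : 4 ≤ s) (hd0 : 0 < d)
    (hd : d < 2 * s) : ¬ ((2 : ℤ) ^ s + 1 ∣ 3 * (2 ^ d - 1)) := by
  obtain ⟨t, rfl⟩ := Nat.exists_eq_add_of_le' hs
  have ht : (1 : ℤ) ≤ 2 ^ t := one_le_pow₀ (by norm_num)
  have h16 : (2 : ℤ) ^ (t + 4) = 16 * 2 ^ t := by ring
  rcases lt_trichotomy d (t + 4) with hlt | heq | hgt
  · rintro ⟨m, hm⟩
    have hd1 : (2 : ℤ) ≤ 2 ^ d := by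
      calc (2 : ℤ) = 2 ^ 1 := by norm_num
        _ ≤ 2 ^ d := pow_le_pow_right₀ (by norm_num) hd0
    have hd2 : (2 : ℤ) ^ d ≤ 8 * 2 ^ t := by
      calc (2 : ℤ) ^ d ≤ 2 ^ (t + 3) := pow_le_pow_right₀ (by norm_num) (by omega)
        _ = 8 * 2 ^ t := by ring
    rw [h16] at hm
    have hm0 : 0 < m := by by_contra! h; nlinarith
    have hm1 : m < 2 := by by_contra! h; nlinarith
    obtain rfl : m = 1 := by omega
    rcases Nat.lt_or_ge d 3 with h3 | h3
    · interval_cases d <;> omega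
    · obtain ⟨e, rfl⟩ := Nat.exists_eq_add_of_le' h3
      rw [pow_add] at hm
      omega
  · subst heq
    intro h
    have h6 : (2 : ℤ) ^ (t + 4) + 1 ∣ 6 := by
      obtain ⟨a, ha⟩ := h
      exact ⟨3 - a, by linear_combination -ha⟩
    have := Int.le_of_dvd (by norm_num) h6
    omega
  · obtain ⟨e, rfl⟩ := Nat.exists_eq_add_of_lt hgt
    intro h
    have h' : (2 : ℤ) ^ (t + 4) + 1 ∣ 3 * (2 ^ (e + 1) + 1) := by
      obtain ⟨a, ha⟩ := h
      exact ⟨3 * 2 ^ (e + 1) - a, by linear_combination -ha⟩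
    obtain ⟨m, hm⟩ := h'
    have hd1 : (0 : ℤ) < 2 ^ (e + 1) := by positivity
    have hd2 : (2 : ℤ) ^ (e + 1) ≤ 8 * 2 ^ t := by
      calc (2 : ℤ) ^ (e + 1) ≤ 2 ^ (t + 3) := pow_le_pow_right₀ (by norm_num) (by omega)
        _ = 8 * 2 ^ t := by ring
    rw [h16] at hm
    have hm0 : 0 < m := by by_contra! h; nlinarith
    have hm1 : m < 2 := by by_contra! h; nlinarith
    obtain rfl : m = 1 := by omega
    rcases Nat.eq_zero_or_pos e with rfl | h3
    · omega
    · obtain ⟨e, rfl⟩ := Nat.exists_eq_add_of_le' h3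
      rw [pow_succ, pow_succ] at hm
      omega

/-- This keeps 3 out of the coset of 1. After reducing by 2^s ≡ -1 when j ≥ s, the number is too
small in absolute value to be a nonzero multiple. -/
theorem not_dvd_three_sub_two_pow {s j : ℕ} (hs : 4 ≤ s) (hj : j < 2 * s) :
    ¬ ((2 : ℤ) ^ s + 1 ∣ 3 - 2 ^ j) := by
  obtain ⟨t, rfl⟩ := Nat.exists_eq_add_of_le' hs
  have ht : (1 : ℤ) ≤ 2 ^ t := one_le_pow₀ (by norm_num)
  have h16 : (2 : ℤ) ^ (t + 4) = 16 * 2 ^ t := by ring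
  have hlow : ∀ e < t + 4, (2 : ℤ) ^ e ≤ 8 * 2 ^ t := fun e he => by
    calc (2 : ℤ) ^ e ≤ 2 ^ (t + 3) := pow_le_pow_right₀ (by norm_num) (by omega)
        _ = 8 * 2 ^ t := by ring
  have hpos : ∀ e, (0 : ℤ) < 2 ^ e := fun e => by positivity
  rcases Nat.lt_or_ge j (t + 4) with hlt | hge
  · intro h
    have h0 := Int.eq_zero_of_abs_lt_dvd h (by
      rw [abs_lt]
      have := hlow j hlt
      have := hpos j
      constructor <;> omega)
    rcases j with _ | j
    · norm_num at h0
    · rw [pow_succ] at h0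
      omega
  · obtain ⟨e, rfl⟩ := Nat.exists_eq_add_of_le hge
    intro h
    have h' : (2 : ℤ) ^ (t + 4) + 1 ∣ 3 + 2 ^ e := by
      obtain ⟨a, ha⟩ := h
      exact ⟨2 ^ e + a, by linear_combination ha⟩
    have := Int.le_of_dvd (by have := hpos e; omega) h'
    have := hlow e (by omega)
    omega

theorem pow_two_pow_two_mul {M : Type*} [Monoid M] {s : ℕ} {β : M} (hβ : β ^ (2 ^ s + 1) = 1) : β ^ 2 ^ (2 * s) = β := by
  have h : 2 ^ (2 * s) = (2 ^ s + 1) * (2 ^ s - 1) + 1 := by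
    have : 1 ≤ 2 ^ s := Nat.one_le_two_pow
    zify [this]
    ring
  rw [h, pow_succ, pow_mul, hβ, one_pow, one_mul]

end CyclotomicCosets

/-! ### The binary code with zeros β and β^3. -/

section Zetterberg

variable {K : Type*} [Field K] {s : ℕ} {β : K}

theorem pow_eq_pow_iff_dvd_sub {n : ℕ} (hn : 0 < n) (hβ : IsPrimitiveRoot β n) {a b : ℕ} :
    β ^ a = β ^ b ↔ (n : ℤ) ∣ b - a := by
  rw [(isOfFinOrder_iff_pow_eq_one.2 ⟨n, hn, hβ.pow_eq_one⟩).pow_eq_pow_iff_modEq,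
    ← hβ.eq_orderOf, Nat.modEq_iff_dvd]

theorem injOn_pow_three_pow_two_pow (hs : 4 ≤ s) (hβ : IsPrimitiveRoot β (2 ^ s + 1)) :
    Set.InjOn (fun i => (β ^ 3) ^ 2 ^ i) (Finset.range (2 * s)) := by
  have key : ∀ i j, i < j → j < 2 * s → (β ^ 3) ^ 2 ^ i ≠ (β ^ 3) ^ 2 ^ j := by
    intro i j hij hj h
    rw [← pow_mul, ← pow_mul, pow_eq_pow_iff_dvd_sub (by positivity) hβ] at h
    obtain ⟨e, rfl⟩ := Nat.exists_eq_add_of_lt hij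
    refine not_dvd_three_mul_two_pow_sub_one hs (d := e + 1) (by omega) (by omega) ?_
    have hco : IsCoprime ((2 : ℤ) ^ s + 1) (2 ^ i) := by
      apply IsCoprime.pow_right
      exact ⟨1, -2 ^ (s - 1), by rw [neg_mul, pow_sub_one_mul (by omega)]; ring⟩
    refine hco.dvd_of_dvd_mul_left (y := 2 ^ i) ?_
    obtain ⟨a, ha⟩ := h
    push_cast at ha
    exact ⟨a, by linear_combination ha⟩
  intro i hi j hj h
  simp only [Finset.coe_range, Set.mem_Iio] at hi hj
  rcases lt_trichotomy i j with hlt | heq | hgt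
  · exact absurd h (key i j hlt hj)
  · exact heq
  · exact absurd h.symm (key j i hgt hi)

/-- Cubing carries a coincidence among conjugates of β to one among conjugates of β^3. -/
theorem injOn_pow_two_pow (hs : 4 ≤ s) (hβ : IsPrimitiveRoot β (2 ^ s + 1)) :
    Set.InjOn (fun i => β ^ 2 ^ i) (Finset.range (2 * s)) := by
  intro i hi j hj h
  refine injOn_pow_three_pow_two_pow hs hβ hi hj ?_
  simp only at h ⊢
  rw [pow_right_comm, h, pow_right_comm]

variable [Algebra (ZMod 2) K]

theorem natDegree_minpoly_pow_three (hs : 4 ≤ s) (hβ : IsPrimitiveRoot β (2 ^ s + 1)) :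
    (minpoly (ZMod 2) (β ^ 3)).natDegree = 2 * s :=
  minpoly_natDegree_eq_of_conjugates (by omega)
    (pow_two_pow_two_mul (by rw [← pow_mul, mul_comm, pow_mul, hβ.pow_eq_one, one_pow]))
    (injOn_pow_three_pow_two_pow hs hβ)

theorem natDegree_minpoly_of_isPrimitiveRoot (hs : 4 ≤ s)
    (hβ : IsPrimitiveRoot β (2 ^ s + 1)) :
    (minpoly (ZMod 2) β).natDegree = 2 * s :=
  minpoly_natDegree_eq_of_conjugates (by omega) (pow_two_pow_two_mul hβ.pow_eq_one)
    (injOn_pow_two_pow hs hβ)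

theorem isIntegral_of_pow_eq_one {n : ℕ} (hn : n ≠ 0) (x : K) (hx : x ^ n = 1) :
    IsIntegral (ZMod 2) x :=
  ⟨X ^ n - 1, monic_X_pow_sub_C 1 hn, by simp [hx]⟩

/-- Otherwise the two minimal polynomials coincide, and one of degree 2s has the 2s conjugates of β
and also β^3 as roots. -/
theorem isCoprime_minpoly_minpoly_pow_three (hs : 4 ≤ s)
    (hβ : IsPrimitiveRoot β (2 ^ s + 1)) :
    IsCoprime (minpoly (ZMod 2) β) (minpoly (ZMod 2) (β ^ 3)) := by
  have h1 : IsIntegral (ZMod 2) β := isIntegral_of_pow_eq_one (by positivity) β hβ.pow_eq_one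
  have h3 : IsIntegral (ZMod 2) (β ^ 3) := h1.pow 3
  rw [(minpoly.irreducible h1).coprime_iff_not_dvd]
  intro hdvd
  have heq : minpoly (ZMod 2) β = minpoly (ZMod 2) (β ^ 3) :=
    eq_of_monic_of_associated (minpoly.monic h1) (minpoly.monic h3)
      ((minpoly.irreducible h1).associated_of_dvd (minpoly.irreducible h3) hdvd)
  classical
  have hne : (minpoly (ZMod 2) β).map (algebraMap (ZMod 2) K) ≠ 0 :=
    map_ne_zero (minpoly.ne_zero h1)
  let T := (Finset.range (2 * s)).image fun i => β ^ 2 ^ i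
  have hnot : β ^ 3 ∉ T := by
    intro h
    obtain ⟨j, hj, h⟩ := Finset.mem_image.1 h
    rw [pow_eq_pow_iff_dvd_sub (by positivity) hβ] at h
    exact not_dvd_three_sub_two_pow hs (Finset.mem_range.1 hj) (by simpa using h)
  have hT : T.card = 2 * s := by
    rw [Finset.card_image_of_injOn (injOn_pow_two_pow hs hβ), Finset.card_range]
  have hsub : insert (β ^ 3) T ⊆
      ((minpoly (ZMod 2) β).map (algebraMap (ZMod 2) K)).roots.toFinset := by
    intro y hy
    rw [Multiset.mem_toFinset, mem_roots hne, IsRoot.def, eval_map_algebraMap]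
    rcases Finset.mem_insert.1 hy with rfl | hy
    · rw [heq, minpoly.aeval]
    · obtain ⟨i, -, rfl⟩ := Finset.mem_image.1 hy
      rw [aeval_pow_two_pow_eq_zero_iff, minpoly.aeval]
  have hcard := Finset.card_le_card hsub
  rw [Finset.card_insert_of_notMem hnot, hT] at hcard
  have := hcard.trans ((Multiset.toFinset_card_le _).trans (card_roots' _))
  rw [natDegree_map, natDegree_minpoly_of_isPrimitiveRoot hs hβ] at this
  omega

theorem aeval_pow_quarter_eq_zero_iff (hs : 2 ≤ s)
    (p : (ZMod 2)[X]) : aeval (β ^ (2 ^ s / 4)) p = 0 ↔ aeval β p = 0 := by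
  obtain ⟨t, rfl⟩ := Nat.exists_eq_add_of_le' hs
  rw [show 2 ^ (t + 2) / 4 = 2 ^ t by rw [pow_add]; omega, aeval_pow_two_pow_eq_zero_iff]

theorem aeval_pow_quarter_add_one_eq_zero_iff (hs : 2 ≤ s) (hβ : β ^ (2 ^ s + 1) = 1)
    (p : (ZMod 2)[X]) : aeval (β ^ (2 ^ s / 4 + 1)) p = 0 ↔ aeval (β ^ 3) p = 0 := by
  obtain ⟨t, rfl⟩ := Nat.exists_eq_add_of_le' hs
  rw [show 2 ^ (t + 2) / 4 = 2 ^ t by rw [pow_add]; omega,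
    ← aeval_pow_two_pow_eq_zero_iff p (β ^ (2 ^ t + 1)) 2, ← pow_mul,
    show (2 ^ t + 1) * 2 ^ 2 = 2 ^ (t + 2) + 1 + 3 by ring, pow_add, hβ, one_mul]

variable {F : Type*} [Field F] [Algebra (ZMod 2) F] [Algebra F K] [IsScalarTower (ZMod 2) F K]

theorem mem_subfieldSubcode_bchCode_iff (hs : 2 ≤ s) (hβ : β ^ (2 ^ s + 1) = 1)
    (c : Fin (2 ^ s + 1) → ZMod 2) :
    c ∈ subfieldSubcode (ZMod 2) (bchCode F (2 ^ s + 1) 3 (2 ^ s / 4) β) ↔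
      aeval β (wordPoly c) = 0 ∧ aeval (β ^ 3) (wordPoly c) = 0 := by
  have hsub : ∀ x : K, ∑ i, algebraMap F K (algebraMap (ZMod 2) F (c i)) * x ^ (i : ℕ) =
      aeval x (wordPoly c) := fun x => by
    rw [aeval_wordPoly]
    simp only [← IsScalarTower.algebraMap_apply]
  have hmem : c ∈ subfieldSubcode (ZMod 2) (bchCode F (2 ^ s + 1) 3 (2 ^ s / 4) β) ↔
      (fun i => algebraMap (ZMod 2) F (c i)) ∈ bchCode F (2 ^ s + 1) 3 (2 ^ s / 4) β := Iff.rfl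
  rw [hmem, mem_bchCode_iff 3 _ hβ, ← aeval_pow_quarter_eq_zero_iff hs,
    ← aeval_pow_quarter_add_one_eq_zero_iff hs hβ]
  simp only [hsub]
  constructor
  · exact fun h => ⟨h 0 (by norm_num), h 1 (by norm_num)⟩
  · rintro ⟨h0, h1⟩ j hj
    rcases (by omega : j = 0 ∨ j = 1) with rfl | rfl
    · exact h0
    · exact h1

theorem finrank_subfieldSubcode_bchCode (hs : 4 ≤ s) (hβ : IsPrimitiveRoot β (2 ^ s + 1)) :
    4 * s < 2 ^ s + 1 ∧ Module.finrank (ZMod 2)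
      (subfieldSubcode (ZMod 2) (bchCode F (2 ^ s + 1) 3 (2 ^ s / 4) β)) =
        2 ^ s + 1 - 4 * s := by
  have h1 : IsIntegral (ZMod 2) β := isIntegral_of_pow_eq_one (by positivity) β hβ.pow_eq_one
  have hlt : 4 * s < 2 ^ s + 1 := by
    clear hβ
    induction s, hs using Nat.le_induction with
    | base => norm_num
    | succ k hk ih => rw [pow_succ]; omega
  have hdeg : (minpoly (ZMod 2) β * minpoly (ZMod 2) (β ^ 3)).natDegree = 4 * s := by
    rw [(minpoly.monic h1).natDegree_mul (minpoly.monic (h1.pow 3)),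
      natDegree_minpoly_of_isPrimitiveRoot hs hβ, natDegree_minpoly_pow_three hs hβ]
    ring
  refine ⟨hlt, ?_⟩
  rw [← hdeg]
  refine finrank_of_mem_iff_dvd ((minpoly.monic h1).mul (minpoly.monic (h1.pow 3)))
    (hdeg.trans_le hlt.le) _ fun c => ?_
  rw [mem_subfieldSubcode_bchCode_iff (by omega) hβ.pow_eq_one, ← minpoly.dvd_iff,
    ← minpoly.dvd_iff]
  exact ⟨fun h => (isCoprime_minpoly_minpoly_pow_three hs hβ).mul_dvd h.1 h.2,
    fun h => ⟨(dvd_mul_right _ _).trans h, (dvd_mul_left _ _).trans h⟩⟩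

theorem five_le_hammingNorm (hs : 2 ≤ s) (hβ : IsPrimitiveRoot β (2 ^ s + 1))
    {c : Fin (2 ^ s + 1) → ZMod 2} (hc0 : c ≠ 0)
    (hc : c ∈ subfieldSubcode (ZMod 2) (bchCode F (2 ^ s + 1) 3 (2 ^ s / 4) β)) :
    5 ≤ hammingNorm c := by
  rw [mem_subfieldSubcode_bchCode_iff hs hβ.pow_eq_one] at hc
  obtain ⟨h1, h3⟩ := hc
  refine lt_hammingNorm_of_sum_pow_eq_zero (m := 4) hβ c hc0 fun j hj1 hj4 => ?_
  rw [← aeval_wordPoly]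
  interval_cases j
  · rwa [pow_one]
  -- The zeros β^2 and β^4 come for free as conjugates of β.
  · exact (aeval_pow_two_pow_eq_zero_iff _ β 1).2 h1
  · exact h3
  · exact (aeval_pow_two_pow_eq_zero_iff _ β 2).2 h1

end Zetterberg

end BCH

theorem mainTheorem10 (s : ℕ) (hs : 4 ≤ s)
    (F : Type*) [Field F] [Algebra (ZMod 2) F] (hF : Nat.card F = 2 ^ s)
    (K : Type*) [Field K] [Algebra F K]
    (β : K) (hβ : IsPrimitiveRoot β (2 ^ s + 1)) :
    ∃ d : ℕ, 5 ≤ d ∧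
      BCH.HasParameters
        (BCH.subfieldSubcode (ZMod 2) (BCH.bchCode F (2 ^ s + 1) 3 (2 ^ s / 4) β))
        (2 ^ s + 1 - 4 * s) d := by
  let _ : Algebra (ZMod 2) K := ((algebraMap F K).comp (algebraMap (ZMod 2) F)).toAlgebra
  have : IsScalarTower (ZMod 2) F K := IsScalarTower.of_algebraMap_eq fun _ => rfl
  obtain ⟨hlt, hdim⟩ := BCH.finrank_subfieldSubcode_bchCode (F := F) hs hβ
  set C := BCH.subfieldSubcode (ZMod 2) (BCH.bchCode F (2 ^ s + 1) 3 (2 ^ s / 4) β) with hC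
  -- Positive dimension supplies a nonzero word, so the `sInf` below is an attained weight and not
  -- the default 0.
  have hne : {w : ℕ | ∃ c ∈ C, c ≠ 0 ∧ hammingNorm c = w}.Nonempty := by
    have : Nontrivial C := Module.nontrivial_of_finrank_pos (R := ZMod 2) (by omega)
    obtain ⟨c, hcC, hc0⟩ := (Submodule.nontrivial_iff_ne_bot.1 this |> C.ne_bot_iff.1)
    exact ⟨_, c, hcC, hc0, rfl⟩
  refine ⟨sInf _, ?_, hdim, Nat.sInf_mem hne, fun w hw => Nat.sInf_le hw⟩
  obtain ⟨c, hcC, hc0, hw⟩ := Nat.sInf_mem hne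
  rw [← hw]
  exact BCH.five_le_hammingNorm (by omega) hβ hc0 hcC
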